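/- Let $X$ be a complex Banach space and $K\subseteq X$ a nonempty compact subset. For $n\in\mathbb N=\{1,2,\dots\}$ let $U_n:=K+B^X_{1/n}(0)=\bigcup_{a\in K}B^X_{1/n}(a)$ be the open $1/n$-neighbourhood of $K$. Let $\mathrm{Hol}_b(U_n,X)_K$ be the space of all bounded complex analytic maps $\gamma\colon U_n\to X$ with $\gamma|_K=0$, normed by $\|\gamma\|_\infty=\sup_{x\in U_n}\|\gamma(x)\|$, and let $\mathrm{BC}^1_{\mathbb C}(U_n,X)_K$ be the space of all bounded complex analytic maps $\gamma\colon U_n\to X$ with bounded Fréchet derivative $\gamma'$ and $\gamma|_K=0$, normed by $\|\gamma\|_{\mathrm D}=\sup_{x\in U_n}\|\gamma'(x)\|_{\mathrm{op}}$. Identify two maps defined on neighbourhoods of $K$ if they coincide on a neighbourhood of $K$. Then $(\mathrm{Hol}_b(U_n,X)_K)_{n\in\mathbb N}$ and $(\mathrm{BC}^1_{\mathbb C}(U_n,X)_K)_{n\in\mathbb N}$, with the restriction maps, are increasing sequences of Banach spaces with continuous inclusions. They have the same union $$\mathrm{Germ}(K,X)_K:=\bigcup_{n\in\mathbb N}\mathrm{Hol}_b(U_n,X)_K=\bigcup_{n\in\mathbb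 N}\mathrm{BC}^1_{\mathbb C}(U_n,X)_K ,$$ and they induce on it the same locally convex direct limit topology (the finest locally convex vector space topology making all inclusions of the steps continuous). The resulting LB-space $\mathrm{Germ}(K,X)_K$ is Hausdorff, and it is compactly regular with respect to both sequences: for every compact subset $C$ of $\mathrm{Germ}(K,X)_K$ there is an $n$ such that $C$ is a compact subset of $\mathrm{Hol}_b(U_n,X)_K$, and there is an $n$ such that $C$ is a compact subset of $\mathrm{BC}^1_{\mathbb C}(U_n,X)_K$. -/

import Mathlib

open Set Filter Topology
open scoped BoundedContinuousFunction

set_option linter.unusedSectionVars false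

noncomputable section

/-! Locally convex direct limits of sequences of normed spaces -/

namespace LCLimit

variable {E : ℕ → Type*} [∀ n, NormedAddCommGroup (E n)] [∀ n, NormedSpace ℂ (E n)]
  {F : Type*} [AddCommGroup F] [Module ℂ F]

/-- The vector space topologies on `F` that are locally convex and make every `ι n` continuous. -/
structure IsAdmissible (ι : ∀ n, E n →ₗ[ℂ] F) (t : TopologicalSpace F) : Prop where
  isTopologicalAddGroup : IsTopologicalAddGroup F
  continuousSMul : ContinuousSMul ℂ F
  locallyConvexSpace : LocallyConvexSpace ℝ F
  continuous : ∀ n, Continuous (ι n)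

/-- The locally convex direct limit topology on `F = ⋃ n, ι n (E n)`: the finest locally convex
vector space topology for which all `ι n` are continuous. The infimum is itself such a topology
(`isAdmissible_topology`), and its convex neighbourhoods of zero are described in
`convex_mem_nhds_zero_iff`. -/
abbrev topology (ι : ∀ n, E n →ₗ[ℂ] F) : TopologicalSpace F :=
  sInf {t | IsAdmissible ι t}

theorem isAdmissible_topology (ι : ∀ n, E n →ₗ[ℂ] F) : IsAdmissible ι (topology ι) where
  isTopologicalAddGroup := topologicalAddGroup_sInf fun _ ht => ht.isTopologicalAddGroup
  continuousSMul := continuousSMul_sInf fun _ ht => ht.continuousSMul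
  locallyConvexSpace := LocallyConvexSpace.sInf fun _ ht => ht.locallyConvexSpace
  continuous n := continuous_sInf_rng.2 fun _ ht => ht.continuous n

/-- If `F` is the union of the images of the `E n`, then a convex subset of `F` is a neighbourhood
of zero for the direct limit topology if and only if its trace on each `E n` is one. -/
theorem convex_mem_nhds_zero_iff (ι : ∀ n, E n →ₗ[ℂ] F)
    (hι : ⋃ n, Set.range (ι n) = Set.univ) {U : Set F} (hU : Convex ℝ U) :
    U ∈ @nhds F (topology ι) 0 ↔ ∀ n, ι n ⁻¹' U ∈ 𝓝 (0 : E n) := by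
  constructor
  · intro h n
    let _ := topology ι
    have hc : Continuous (ι n) := (isAdmissible_topology ι).continuous n
    exact hc.continuousAt.preimage_mem_nhds (by simpa using h)
  · intro h
    set V : Set F := {x | ∀ z : ℂ, ‖z‖ ≤ 1 → z • x ∈ U} with hV
    have hVU : V ⊆ U := fun x hx => by simpa using hx 1 (by simp)
    have hVc : Convex ℝ V := by
      intro x hx y hy a b ha hb hab z hz
      rw [smul_add, smul_comm z a, smul_comm z b]
      exact hU (hx z hz) (hy z hz) ha hb hab
    have hVb : Balanced ℂ V := by
      intro a ha
      rintro _ ⟨x, hx, rfl⟩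
      intro z hz
      change z • a • x ∈ U
      rw [smul_smul]
      exact hx _ (by rw [norm_mul]; exact mul_le_one₀ hz (norm_nonneg _) ha)
    have hball : ∀ n, ∃ ε > 0, ∀ x : E n, ‖x‖ < ε → ι n x ∈ V := by
      intro n
      obtain ⟨ε, hε, hs⟩ := Metric.mem_nhds_iff.1 (h n)
      refine ⟨ε, hε, fun x hx z hz => ?_⟩
      rw [← map_smul]
      refine hs ?_
      rw [mem_ball_zero_iff, norm_smul]
      exact lt_of_le_of_lt (mul_le_of_le_one_left (norm_nonneg _) hz) hx
    have hcov : ∀ y : F, ∃ n, ∃ x : E n, ι n x = y := by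
      intro y
      have : y ∈ ⋃ n, Set.range (ι n) := hι ▸ Set.mem_univ y
      simpa using this
    have hVa : Absorbent ℝ V := by
      intro y
      obtain ⟨n, x, rfl⟩ := hcov y
      obtain ⟨ε, hε, hs⟩ := hball n
      rw [absorbs_iff_norm]
      refine ⟨(‖x‖ + 1) / ε, fun c hc => ?_⟩
      have hc0 : 0 < ‖c‖ := lt_of_lt_of_le (by positivity) hc
      have hcne : c ≠ 0 := norm_pos_iff.1 hc0
      rw [Set.singleton_subset_iff, Set.mem_smul_set_iff_inv_smul_mem₀ hcne]
      have : c⁻¹ • ι n x = ι n (((c⁻¹ : ℝ) : ℂ) • x) := by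
        rw [map_smul]; rfl
      rw [this]
      refine hs _ ?_
      rw [norm_smul, Complex.norm_real, norm_inv, inv_mul_lt_iff₀ hc0]
      rw [div_le_iff₀ hε] at hc
      linarith
    let p : Seminorm ℂ F := gaugeSeminorm hVb hVc hVa
    let _ : SeminormedAddCommGroup F := p.toSeminormedAddCommGroup
    let _ : NormedSpace ℂ F := { norm_smul_le := fun a b => (map_smul_eq_mul p a b).le }
    have hadm : IsAdmissible ι inferInstance := by
      refine ⟨inferInstance, inferInstance, inferInstance, fun n => ?_⟩
      obtain ⟨ε, hε, hs⟩ := hball n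
      refine AddMonoidHomClass.continuous_of_bound (ι n) (2 / ε) fun x => ?_
      change gauge V (ι n x) ≤ _
      by_cases hx : ‖x‖ = 0
      · have hx0 : x = 0 := norm_eq_zero.1 hx
        simp [hx0, gauge_zero]
      · have hxp : 0 < ‖x‖ := lt_of_le_of_ne (norm_nonneg _) (Ne.symm hx)
        have hr : 0 < 2 / ε * ‖x‖ := by positivity
        refine gauge_le_of_mem hr.le ?_
        rw [Set.mem_smul_set_iff_inv_smul_mem₀ hr.ne']
        have : (2 / ε * ‖x‖)⁻¹ • ι n x = ι n ((((2 / ε * ‖x‖)⁻¹ : ℝ) : ℂ) • x) := by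
          rw [map_smul]; rfl
        rw [this]
        refine hs _ ?_
        rw [norm_smul, Complex.norm_real, norm_inv, Real.norm_of_nonneg hr.le,
          inv_mul_lt_iff₀ hr]
        have : 2 / ε * ‖x‖ * ε = 2 * ‖x‖ := by field_simp
        linarith
    have hle : topology ι ≤ (inferInstance : TopologicalSpace F) := sInf_le hadm
    refine nhds_mono hle ?_
    refine Filter.mem_of_superset (Metric.ball_mem_nhds (0 : F) one_pos) fun x hx => ?_
    rw [mem_ball_zero_iff] at hx
    exact hVU (setOfPred_gauge_lt_one_subset_self hVc hVa.zero_mem hVa hx)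

/-- `F` is the increasing union of the Banach spaces `E n` (viewed as subspaces of `F` through the
injections `ι n`), with continuous inclusions `E n → E (n + 1)`. With `topology ι`, such an `F` is
what is called an LB-space. -/
structure IsBanachUnion (ι : ∀ n, E n →ₗ[ℂ] F) : Prop where
  complete : ∀ n, CompleteSpace (E n)
  injective : ∀ n, Function.Injective (ι n)
  bonding : ∀ n, ∃ i : E n →L[ℂ] E (n + 1), ∀ x, ι (n + 1) (i x) = ι n x
  union : ⋃ n, Set.range (ι n) = Set.univ

/-- Every compact subset of the direct limit is a compact subset of some step `E n`. -/
def CompactlyRegular (ι : ∀ n, E n →ₗ[ℂ] F) : Prop :=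
  ∀ C : Set F, @IsCompact F (topology ι) C → ∃ n, ∃ C' : Set (E n), IsCompact C' ∧ ι n '' C' = C

end LCLimit

/-! Spaces of analytic germs around a set `K` -/

namespace AnalyticGerm

variable {X : Type*} [NormedAddCommGroup X] [NormedSpace ℂ X]

/-- The neighbourhoods `K + B(0, 1/(n+1))`, for `n = 0, 1, 2, …`. -/
def U (K : Set X) (n : ℕ) : Set X := ⋃ a ∈ K, Metric.ball a (1 / ((n : ℝ) + 1))

theorem isOpen_U (K : Set X) (n : ℕ) : IsOpen (U K n) :=
  isOpen_biUnion fun _ _ => Metric.isOpen_ball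

theorem subset_U (K : Set X) (n : ℕ) : K ⊆ U K n := fun a ha =>
  Set.mem_biUnion ha (Metric.mem_ball_self (by positivity))

theorem U_anti (K : Set X) {n m : ℕ} (h : n ≤ m) : U K m ⊆ U K n := by
  refine Set.iUnion₂_mono fun a _ => Metric.ball_subset_ball ?_
  have : (n : ℝ) ≤ m := by exact_mod_cast h
  gcongr

open Classical in
/-- Extension by zero, used to speak about analyticity and derivatives of `f` on the open set `W`
and about its germ. -/
def zeroExt {W : Set X} (f : W → X) (x : X) : X := if h : x ∈ W then f ⟨x, h⟩ else 0

theorem zeroExt_of_mem {W : Set X} (f : W → X) {x : X} (h : x ∈ W) :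
    zeroExt f x = f ⟨x, h⟩ := dif_pos h

theorem zeroExt_add {W : Set X} (f g : W → X) : zeroExt (f + g) = zeroExt f + zeroExt g := by
  funext x
  by_cases h : x ∈ W <;> simp [zeroExt, h]

theorem zeroExt_smul {W : Set X} (c : ℂ) (f : W → X) : zeroExt (c • f) = c • zeroExt f := by
  funext x
  by_cases h : x ∈ W <;> simp [zeroExt, h]

theorem zeroExt_zero {W : Set X} : zeroExt (0 : W → X) = 0 := by
  funext x
  by_cases h : x ∈ W <;> simp [zeroExt, h]

/-- `Hol_b(U_n, X)_K`: the bounded analytic maps `U_n → X` vanishing on `K`, with the sup norm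
(the one of bounded continuous maps). -/
def HolB (K : Set X) (n : ℕ) : Submodule ℂ (U K n →ᵇ X) where
  carrier := {f | AnalyticOnNhd ℂ (zeroExt f) (U K n) ∧ ∀ x : U K n, (x : X) ∈ K → f x = 0}
  add_mem' := by
    rintro f g ⟨hf, hf0⟩ ⟨hg, hg0⟩
    refine ⟨?_, fun x hx => by simp [hf0 x hx, hg0 x hx]⟩
    rw [BoundedContinuousFunction.coe_add, zeroExt_add]
    exact hf.add hg
  zero_mem' := by
    refine ⟨?_, fun x _ => rfl⟩
    rw [BoundedContinuousFunction.coe_zero, zeroExt_zero]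
    exact analyticOnNhd_const
  smul_mem' := by
    rintro c f ⟨hf, hf0⟩
    refine ⟨?_, fun x hx => by simp [hf0 x hx]⟩
    rw [BoundedContinuousFunction.coe_smul]
    change AnalyticOnNhd ℂ (zeroExt (c • (f : U K n → X))) (U K n)
    rw [zeroExt_smul]
    exact fun x hx => analyticAt_const.smul (hf x hx)

/-- The maps in `Hol_b(U_n, X)_K` whose Fréchet derivative is bounded on `U_n`. -/
def bc1Submodule (K : Set X) (n : ℕ) : Submodule ℂ (HolB K n) where
  carrier := {f | ∃ C : ℝ, ∀ x ∈ U K n, ‖fderiv ℂ (zeroExt (f : U K n →ᵇ X)) x‖ ≤ C}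
  add_mem' := by
    rintro f g ⟨C, hC⟩ ⟨D, hD⟩
    refine ⟨C + D, fun x hx => ?_⟩
    rw [Submodule.coe_add, BoundedContinuousFunction.coe_add, zeroExt_add,
      fderiv_add (f.2.1 x hx).differentiableAt (g.2.1 x hx).differentiableAt]
    exact (norm_add_le _ _).trans (add_le_add (hC x hx) (hD x hx))
  zero_mem' := by
    refine ⟨0, fun x _ => ?_⟩
    rw [Submodule.coe_zero, BoundedContinuousFunction.coe_zero, zeroExt_zero]
    simp
  smul_mem' := by
    rintro c f ⟨C, hC⟩
    refine ⟨‖c‖ * C, fun x hx => ?_⟩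
    rw [Submodule.coe_smul, BoundedContinuousFunction.coe_smul]
    change ‖fderiv ℂ (zeroExt (c • ((f : U K n →ᵇ X) : U K n → X))) x‖ ≤ _
    rw [zeroExt_smul, fderiv_const_smul (f.2.1 x hx).differentiableAt, norm_smul]
    exact mul_le_mul_of_nonneg_left (hC x hx) (norm_nonneg _)

/-- `BC¹(U_n, X)_K`: the bounded analytic maps `U_n → X` with bounded first derivative that vanish
on `K`. It carries its own norm, see `BC1.norm_eq`. -/
def BC1 (K : Set X) (n : ℕ) : Type _ := ↥(bc1Submodule K n)

instance (K : Set X) (n : ℕ) : AddCommGroup (BC1 K n) :=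
  inferInstanceAs (AddCommGroup ↥(bc1Submodule K n))

instance (K : Set X) (n : ℕ) : Module ℂ (BC1 K n) :=
  inferInstanceAs (Module ℂ ↥(bc1Submodule K n))

namespace BC1

/-- The inclusion of `BC¹(U_n, X)_K` into `Hol_b(U_n, X)_K`. -/
def toHolB (K : Set X) (n : ℕ) : BC1 K n →ₗ[ℂ] HolB K n := (bc1Submodule K n).subtype

variable [CompleteSpace X]

/-- The derivative `γ ↦ γ'` as a map into the bounded continuous maps `U_n → L(X, X)`. -/
def deriv (K : Set X) (n : ℕ) : BC1 K n →ₗ[ℂ] (U K n →ᵇ (X →L[ℂ] X)) where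
  toFun f := BoundedContinuousFunction.ofNormedAddCommGroup
    (fun x : U K n => fderiv ℂ (zeroExt (toHolB K n f : U K n →ᵇ X)) x)
    ((toHolB K n f).2.1.fderiv.continuousOn.domRestrict)
    f.2.choose (fun x => f.2.choose_spec x x.2)
  map_add' f g := by
    ext1 x
    change fderiv ℂ (zeroExt (((toHolB K n f : U K n →ᵇ X) : U K n → X)
      + ((toHolB K n g : U K n →ᵇ X) : U K n → X))) x = _
    rw [zeroExt_add, fderiv_add ((toHolB K n f).2.1 x x.2).differentiableAt
      ((toHolB K n g).2.1 x x.2).differentiableAt]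
    rfl
  map_smul' c f := by
    ext1 x
    change fderiv ℂ (zeroExt (c • ((toHolB K n f : U K n →ᵇ X) : U K n → X))) x = _
    rw [zeroExt_smul, fderiv_const_smul ((toHolB K n f).2.1 x x.2).differentiableAt]
    rfl

theorem deriv_apply (K : Set X) (n : ℕ) (f : BC1 K n) (x : U K n) :
    deriv K n f x = fderiv ℂ (zeroExt (toHolB K n f : U K n →ᵇ X)) x := rfl

theorem deriv_injective (K : Set X) (n : ℕ) : Function.Injective (deriv K n) := by
  refine (injective_iff_map_eq_zero (deriv K n)).2 fun f hf => ?_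
  refine Subtype.ext (Subtype.ext (BoundedContinuousFunction.ext fun x => ?_))
  change (toHolB K n f : U K n →ᵇ X) x = 0
  obtain ⟨a, ha, hxa⟩ := Set.mem_iUnion₂.1 x.2
  have hsub : Metric.ball a (1 / ((n : ℝ) + 1)) ⊆ U K n :=
    fun _ hy => Set.mem_biUnion ha hy
  have haU : a ∈ U K n := subset_U K n ha
  have hd : ∀ y ∈ Metric.ball a (1 / ((n : ℝ) + 1)),
      DifferentiableAt ℂ (zeroExt (toHolB K n f : U K n →ᵇ X)) y :=
    fun y hy => ((toHolB K n f).2.1 y (hsub hy)).differentiableAt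
  have hb : ∀ y ∈ Metric.ball a (1 / ((n : ℝ) + 1)),
      ‖fderiv ℂ (zeroExt (toHolB K n f : U K n →ᵇ X)) y‖ ≤ 0 := fun y hy => by
    rw [← deriv_apply K n f ⟨y, hsub hy⟩, hf]
    simp
  have := (convex_ball a (1 / ((n : ℝ) + 1))).norm_image_sub_le_of_norm_fderiv_le (𝕜 := ℂ) hd hb
    (Metric.mem_ball_self (by positivity)) hxa
  rw [zero_mul, norm_le_zero_iff, sub_eq_zero, zeroExt_of_mem _ x.2, zeroExt_of_mem _ haU,
    (toHolB K n f).2.2 ⟨a, haU⟩ ha] at this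
  exact this

instance (K : Set X) (n : ℕ) : NormedAddCommGroup (BC1 K n) :=
  NormedAddCommGroup.induced (BC1 K n) (U K n →ᵇ (X →L[ℂ] X)) (deriv K n) (deriv_injective K n)

instance (K : Set X) (n : ℕ) : NormedSpace ℂ (BC1 K n) :=
  NormedSpace.induced ℂ (BC1 K n) (U K n →ᵇ (X →L[ℂ] X)) (deriv K n)

/-- The norm of `BC¹(U_n, X)_K` is `‖γ‖_D = sup_{x ∈ U_n} ‖γ'(x)‖`. -/
theorem norm_eq (K : Set X) (n : ℕ) (f : BC1 K n) :
    ‖f‖ = ⨆ x : U K n, ‖fderiv ℂ (zeroExt (toHolB K n f : U K n →ᵇ X)) x‖ :=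
  (deriv K n f).norm_eq_iSup_norm

end BC1

/-- Restriction `Hol_b(U_n, X)_K → Hol_b(U_m, X)_K` for `n ≤ m`. -/
def restrict (K : Set X) {n m : ℕ} (h : n ≤ m) (f : HolB K n) : HolB K m :=
  ⟨(f : U K n →ᵇ X).compContinuous ⟨Set.inclusion (U_anti K h), continuous_inclusion _⟩, by
    refine ⟨?_, fun x hx => f.2.2 _ hx⟩
    refine (f.2.1.mono (U_anti K h)).congr (isOpen_U K m) fun x hx => ?_
    rw [zeroExt_of_mem _ hx, zeroExt_of_mem _ (U_anti K h hx)]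
    rfl⟩

/-- The germ along `K` of a map in `Hol_b(U_n, X)_K`; two maps have the same germ if and only if
they coincide on a neighbourhood of `K`. -/
def germ (K : Set X) (n : ℕ) : HolB K n →ₗ[ℂ] Filter.Germ (𝓝ˢ K) X where
  toFun f := ((zeroExt (f : U K n →ᵇ X) : X → X) : Filter.Germ (𝓝ˢ K) X)
  map_add' f g := by
    rw [Submodule.coe_add, BoundedContinuousFunction.coe_add, zeroExt_add]
    rfl
  map_smul' c f := by
    change ((zeroExt (c • ((f : U K n →ᵇ X) : U K n → X)) : X → X) : Filter.Germ (𝓝ˢ K) X) = _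
    rw [zeroExt_smul]
    rfl

theorem germ_restrict (K : Set X) {n m : ℕ} (h : n ≤ m) (f : HolB K n) :
    germ K m (restrict K h f) = germ K n f := by
  refine Filter.Germ.coe_eq.2 ?_
  filter_upwards [(isOpen_U K m).mem_nhdsSet.2 (subset_U K m)] with x hx
  rw [zeroExt_of_mem _ hx, zeroExt_of_mem _ (U_anti K h hx)]
  rfl

/-- The union over `n` of the spaces `Hol_b(U_n, X)_K`, inside the germs of maps along `K`. -/
def germSubmodule (K : Set X) : Submodule ℂ (Filter.Germ (𝓝ˢ K) X) where
  carrier := ⋃ n, Set.range (germ K n)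
  add_mem' := by
    intro a b ha hb
    obtain ⟨n, f, rfl⟩ := Set.mem_iUnion.1 ha
    obtain ⟨m, g, rfl⟩ := Set.mem_iUnion.1 hb
    refine Set.mem_iUnion.2 ⟨max n m,
      restrict K (le_max_left n m) f + restrict K (le_max_right n m) g, ?_⟩
    rw [map_add, germ_restrict, germ_restrict]
  zero_mem' := Set.mem_iUnion.2 ⟨0, 0, map_zero _⟩
  smul_mem' := by
    intro c a ha
    obtain ⟨n, f, rfl⟩ := Set.mem_iUnion.1 ha
    exact Set.mem_iUnion.2 ⟨n, c • f, map_smul _ _ _⟩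

/-- `Germ(K, X)_K`. -/
def GermK (K : Set X) : Type _ := ↥(germSubmodule K)

instance (K : Set X) : AddCommGroup (GermK K) := inferInstanceAs (AddCommGroup ↥(germSubmodule K))

instance (K : Set X) : Module ℂ (GermK K) := inferInstanceAs (Module ℂ ↥(germSubmodule K))

/-- The canonical maps `Hol_b(U_n, X)_K → Germ(K, X)_K`. -/
def holIncl (K : Set X) (n : ℕ) : HolB K n →ₗ[ℂ] GermK K :=
  (germ K n).codRestrict (germSubmodule K) fun f => Set.mem_iUnion.2 ⟨n, f, rfl⟩

/-- The canonical maps `BC¹(U_n, X)_K → Germ(K, X)_K`. -/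
def bc1Incl (K : Set X) (n : ℕ) : BC1 K n →ₗ[ℂ] GermK K :=
  (holIncl K n).comp (BC1.toHolB K n)

/-- `Germ(K, X)_K` carries the locally convex direct limit topology of the `Hol_b(U_n, X)_K`. -/
instance (K : Set X) : TopologicalSpace (GermK K) := LCLimit.topology (holIncl K)

end AnalyticGerm

end

/-! The proof rests on one interpolation property, `IsInterpolating`: on a bounded subset of `E n`,
smallness in any step `E l` forces smallness in `E (n + 1)`. For analytic germs this is Hadamard's
three-circle theorem. A point `x` of `U K (n + 1)` lies in a ball around some `a ∈ K`. Along the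
complex line `z ↦ a + z • (x - a)`, a map `f` of norm at most `c` on `U K n` is bounded by `c` on a
disc of radius greater than 1. It is bounded by `δ` on a small disc if its germ has norm at most `δ`
in step `l`. Hence `‖f x‖ ≤ δ ^ (1 - θ) * c ^ θ`, with `θ` depending only on the radii
(`holIncl_interpolation`).

In the abstract part, convex neighbourhoods of zero are unions of growing finite sums of small
balls, one from each step, with radii chosen recursively so that an invariant survives. One
invariant shows that, on bounded subsets of `E n`, the limit topology is finer than that of `E (n +
1)` (`exists_mem_nhds_inter_subset`); this gives the Hausdorff property. Another separates zero from
any sequence escaping the unit balls (`exists_mem_nhds_forall_notMem`), so compact sets are bounded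
in a step. Combining the two, a compact set is compact in a step.

The spaces `HolB` are complete because uniform limits of analytic maps are analytic. The `BC1`
spaces interleave with them through continuous inclusions, by Cauchy's estimate and the mean value
inequality, so topology and compact regularity carry over. -/

namespace LCLimit

/-! ### Balls of the steps inside the union -/

open scoped Pointwise

variable {E : ℕ → Type*} [∀ n, NormedAddCommGroup (E n)] [∀ n, NormedSpace ℂ (E n)]
  {F : Type*} [AddCommGroup F] [Module ℂ F]

/-- The image in `F` of the closed ball of radius `c` of the step `E n`. -/
def ballImage (ι : ∀ n, E n →ₗ[ℂ] F) (n : ℕ) (c : ℝ) : Set F := ι n '' Metric.closedBall 0 c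

section ballImage

variable {ι : ∀ n, E n →ₗ[ℂ] F} {n : ℕ} {c d : ℝ} {x y : F}

theorem mem_ballImage : y ∈ ballImage ι n c ↔ ∃ x : E n, ‖x‖ ≤ c ∧ ι n x = y := by
  simp [ballImage]

theorem map_mem_ballImage {x : E n} (h : ‖x‖ ≤ c) : ι n x ∈ ballImage ι n c :=
  mem_ballImage.2 ⟨x, h, rfl⟩

theorem norm_le_of_map_mem_ballImage (hι : Function.Injective (ι n)) {x : E n}
    (h : ι n x ∈ ballImage ι n c) : ‖x‖ ≤ c := by
  obtain ⟨y, hy, e⟩ := mem_ballImage.1 h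
  rwa [← hι e]

theorem ballImage_mono (h : c ≤ d) : ballImage ι n c ⊆ ballImage ι n d :=
  image_mono (Metric.closedBall_subset_closedBall h)

theorem zero_mem_ballImage (h : 0 ≤ c) : (0 : F) ∈ ballImage ι n c :=
  mem_ballImage.2 ⟨0, by simpa using h, map_zero _⟩

theorem add_mem_ballImage (hx : x ∈ ballImage ι n c) (hy : y ∈ ballImage ι n d) :
    x + y ∈ ballImage ι n (c + d) := by
  obtain ⟨u, hu, rfl⟩ := mem_ballImage.1 hx
  obtain ⟨v, hv, rfl⟩ := mem_ballImage.1 hy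
  exact mem_ballImage.2 ⟨u + v, (norm_add_le _ _).trans (add_le_add hu hv), map_add _ _ _⟩

theorem sub_mem_ballImage (hx : x ∈ ballImage ι n c) (hy : y ∈ ballImage ι n d) :
    x - y ∈ ballImage ι n (c + d) := by
  obtain ⟨u, hu, rfl⟩ := mem_ballImage.1 hx
  obtain ⟨v, hv, rfl⟩ := mem_ballImage.1 hy
  exact mem_ballImage.2 ⟨u - v, (norm_sub_le _ _).trans (add_le_add hu hv), map_sub _ _ _⟩

theorem smul_mem_ballImage (a : ℂ) (hx : x ∈ ballImage ι n c) :
    a • x ∈ ballImage ι n (‖a‖ * c) := by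
  obtain ⟨u, hu, rfl⟩ := mem_ballImage.1 hx
  refine mem_ballImage.2 ⟨a • u, ?_, map_smul _ _ _⟩
  rw [norm_smul]
  exact mul_le_mul_of_nonneg_left hu (norm_nonneg _)

theorem convex_ballImage (ι : ∀ n, E n →ₗ[ℂ] F) (n : ℕ) (c : ℝ) :
    Convex ℝ (ballImage ι n c) :=
  (convex_closedBall (0 : E n) c).linear_image ((ι n).restrictScalars ℝ)

theorem eq_zero_of_forall_mem_ballImage (hι : Function.Injective (ι n))
    (h : ∀ ε > 0, y ∈ ballImage ι n ε) : y = 0 := by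
  obtain ⟨x, -, rfl⟩ := mem_ballImage.1 (h 1 one_pos)
  have : ‖x‖ ≤ 0 := le_of_forall_pos_le_add fun ε hε => by
    simpa using norm_le_of_map_mem_ballImage hι (h ε hε)
  rw [norm_le_zero_iff.1 this, map_zero]

theorem add_ballImage_mono {D : Set F} (h : c ≤ d) :
    D + ballImage ι n c ⊆ D + ballImage ι n d :=
  add_subset_add_left (ballImage_mono h)

end ballImage

/-! ### Direct limits with the interpolation property -/

/-- An increasing union of Banach spaces with non-expansive inclusions in which, on bounded subsets
of `E n`, all the norms of the steps beyond `n` define the same topology near zero. -/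
structure IsInterpolating (ι : ∀ n, E n →ₗ[ℂ] F) : Prop where
  complete : ∀ n, CompleteSpace (E n)
  injective : ∀ n, Function.Injective (ι n)
  union : ⋃ n, Set.range (ι n) = Set.univ
  ballImage_succ : ∀ n c, ballImage ι n c ⊆ ballImage ι (n + 1) c
  interpolation : ∀ (n l : ℕ), ∀ c > 0, ∀ ε > 0, ∃ δ > 0,
    ballImage ι n c ∩ ballImage ι l δ ⊆ ballImage ι (n + 1) ε

namespace IsInterpolating

variable {ι : ∀ n, E n →ₗ[ℂ] F}

theorem ballImage_le (h : IsInterpolating ι) {n m : ℕ} (hnm : n ≤ m) (c : ℝ) :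
    ballImage ι n c ⊆ ballImage ι m c := by
  induction m, hnm using Nat.le_induction with
  | base => exact subset_rfl
  | succ m _ ih => exact ih.trans (h.ballImage_succ m c)

theorem ballImage_subset (h : IsInterpolating ι) {n m : ℕ} (hnm : n ≤ m) {c d : ℝ} (hcd : c ≤ d) :
    ballImage ι n c ⊆ ballImage ι m d :=
  (h.ballImage_le hnm c).trans (ballImage_mono hcd)

/-- An element that is approximated, in some step, by a bounded subset `D` of `E n` lies in
`E (n + 1)` and is approximated by `D` there. -/
theorem mem_add_of_forall_mem_add (h : IsInterpolating ι) {n l : ℕ} {c : ℝ} (hc : 0 < c)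
    {D : Set F} (hD : D ⊆ ballImage ι n c) {y : F} (hy : ∀ η > 0, y ∈ D + ballImage ι l η)
    {ε : ℝ} (hε : 0 < ε) : y ∈ D + ballImage ι (n + 1) ε := by
  have := h.complete (n + 1)
  have hpos : ∀ i : ℕ, 0 < 1 / ((i : ℝ) + 1) := fun i => by positivity
  have hex : ∀ i : ℕ, ∃ u : E (n + 1), ι (n + 1) u ∈ D ∧
      y - ι (n + 1) u ∈ ballImage ι l (1 / ((i : ℝ) + 1)) := by
    intro i
    obtain ⟨d, hd, b, hb, rfl⟩ := mem_add.1 (hy _ (hpos i))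
    obtain ⟨u, -, rfl⟩ := mem_ballImage.1 (h.ballImage_succ n c (hD hd))
    exact ⟨u, hd, by simpa using hb⟩
  choose u huD hu using hex
  -- Differences of the approximants are bounded by `c + c` in `E n` and small in `E l`, so
  -- interpolation makes them small in `E (n + 1)`.
  have hcau : CauchySeq u := by
    refine Metric.cauchySeq_iff'.2 fun ε hε => ?_
    obtain ⟨δ, hδ, hs⟩ := h.interpolation n l (c + c) (by positivity) (ε / 2) (by positivity)
    obtain ⟨N, hN⟩ := exists_nat_one_div_lt (half_pos hδ)
    refine ⟨N, fun i hi => ?_⟩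
    have hi' : 1 / ((i : ℝ) + 1) ≤ δ / 2 :=
      (one_div_le_one_div_of_le (by positivity) (by gcongr)).trans hN.le
    have h1 : ι (n + 1) (u i - u N) ∈ ballImage ι (n + 1) (ε / 2) := by
      rw [map_sub]
      refine hs ⟨sub_mem_ballImage (hD (huD i)) (hD (huD N)), ?_⟩
      have := sub_mem_ballImage (hu N) (hu i)
      rw [sub_sub_sub_cancel_left] at this
      exact ballImage_mono (by linarith) this
    have h2 := norm_le_of_map_mem_ballImage (h.injective _) h1
    rw [dist_eq_norm]
    linarith
  obtain ⟨z, hz⟩ := cauchySeq_tendsto_of_complete hcau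
  have hclose : ∀ ε > 0, ∀ᶠ i in atTop, ι (n + 1) (z - u i) ∈ ballImage ι (n + 1) ε := by
    intro ε hε
    filter_upwards [Metric.tendsto_nhds.1 hz ε hε] with i hi
    refine map_mem_ballImage ?_
    rw [dist_comm, dist_eq_norm] at hi
    exact hi.le
  -- `y` and the limit `z` are compared in step `max l (n + 1)`, where both approximation estimates
  -- are available.
  have hyz : y - ι (n + 1) z = 0 := by
    refine eq_zero_of_forall_mem_ballImage (h.injective (max l (n + 1))) fun ε hε => ?_
    have hsmall : ∀ᶠ i : ℕ in atTop, 1 / ((i : ℝ) + 1) < ε / 2 :=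
      tendsto_one_div_add_atTop_nhds_zero_nat.eventually_lt_const (half_pos hε)
    obtain ⟨i, hi, hi'⟩ := ((hclose (ε / 2) (half_pos hε)).and hsmall).exists
    have := sub_mem_ballImage (h.ballImage_subset (le_max_left l (n + 1)) hi'.le (hu i))
      (h.ballImage_le (le_max_right l (n + 1)) _ hi)
    rw [map_sub, add_halves, sub_sub_sub_cancel_right] at this
    exact this
  rw [sub_eq_zero] at hyz
  obtain ⟨i, hi⟩ := (hclose ε hε).exists
  refine mem_add.2 ⟨_, huD i, _, hi, ?_⟩
  rw [map_sub, add_sub_cancel, hyz]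

/-- Convex neighbourhoods of zero as unions of recursively constructed sums of small balls. -/
theorem exists_convex_mem_nhds (h : IsInterpolating ι) (k : ℕ) (G : ℕ → Set F → Prop)
    (h0 : G k {0})
    (hs : ∀ N ≥ k, ∀ D, G N D → ∃ δ > 0, G (N + 1) (D + ballImage ι (N + 1) δ)) :
    ∃ V ∈ @nhds F (topology ι) 0, ∀ x ∈ V, ∀ M, ∃ N ≥ M, ∃ D, x ∈ D ∧ G N D := by
  choose! δ hδ hG using hs
  -- The radius of each new ball depends on the sum built so far; `G` is the invariant that this
  -- choice preserves.
  let D : ℕ → Set F :=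
    fun i => Nat.rec {0} (fun j A => A + ballImage ι (k + j + 1) (δ (k + j) A)) i
  have hDs : ∀ i, D (i + 1) = D i + ballImage ι (k + i + 1) (δ (k + i) (D i)) := fun i => rfl
  have hDG : ∀ i, G (k + i) (D i) := by
    intro i
    induction i with
    | zero => exact h0
    | succ i ih => exact hG _ (Nat.le_add_right k i) _ ih
  have hδ' : ∀ i, 0 < δ (k + i) (D i) := fun i => hδ _ (Nat.le_add_right k i) _ (hDG i)
  have hD0 : ∀ i, (0 : F) ∈ D i := by
    intro i
    induction i with
    | zero => exact mem_singleton _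
    | succ i ih =>
      rw [hDs]
      exact mem_add.2 ⟨0, ih, 0, zero_mem_ballImage (hδ' i).le, add_zero _⟩
  have hDc : ∀ i, Convex ℝ (D i) := by
    intro i
    induction i with
    | zero => exact convex_singleton _
    | succ i ih =>
      rw [hDs]
      exact ih.add (convex_ballImage _ _ _)
  have hDm : Monotone D := by
    refine monotone_nat_of_le_succ fun i x hx => ?_
    rw [hDs]
    exact mem_add.2 ⟨x, hx, 0, zero_mem_ballImage (hδ' i).le, add_zero _⟩
  refine ⟨⋃ i, D i, ?_, fun x hx M => ?_⟩
  -- The trace on `E m` contains a ball, since `D (m + 1)` has a summand from step `k + m + 1 ≥ m`.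
  · refine (convex_mem_nhds_zero_iff ι h.union
      (hDm.directed_le.convex_iUnion hDc)).2 fun m => ?_
    refine mem_of_superset (Metric.closedBall_mem_nhds 0 (hδ' m)) fun x hx => ?_
    refine mem_iUnion.2 ⟨m + 1, ?_⟩
    rw [hDs]
    refine mem_add.2 ⟨0, hD0 m, ι m x, ?_, zero_add _⟩
    exact h.ballImage_le (by omega) _ (mem_image_of_mem _ hx)
  · obtain ⟨i, hi⟩ := mem_iUnion.1 hx
    exact ⟨k + max i M, by omega, D (max i M), hDm (le_max_left i M) hi, hDG _⟩

/-- On bounded subsets of `E n`, the direct limit topology is finer than the one of `E (n + 1)`. -/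
theorem exists_mem_nhds_inter_subset (h : IsInterpolating ι) (n : ℕ) {c ε : ℝ} (hc : 0 < c)
    (hε : 0 < ε) :
    ∃ V ∈ @nhds F (topology ι) 0, ballImage ι n c ∩ V ⊆ ballImage ι (n + 1) ε := by
  -- Invariant: `D` is bounded in step `N`, and the desired inclusion still holds after thickening
  -- `D` by some ball of step `N + 2`. This slack leaves room for the next summand.
  refine (h.exists_convex_mem_nhds n
    (fun N D => (∃ d > 0, D ⊆ ballImage ι N d) ∧
      ∃ η > 0, ballImage ι n c ∩ (D + ballImage ι (N + 2) η) ⊆ ballImage ι (n + 1) ε)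
    ?_ ?_).imp fun V hV => ⟨hV.1, fun x hxV => ?_⟩
  · refine ⟨⟨1, one_pos, by simpa using zero_mem_ballImage zero_le_one⟩, ?_⟩
    obtain ⟨δ, hδ, hs⟩ := h.interpolation n (n + 2) c hc ε hε
    exact ⟨δ, hδ, by simpa using hs⟩
  · rintro N hN D ⟨⟨d, hd, hDd⟩, η, hη, hs⟩
    have hsub : D + ballImage ι (N + 1) (η / 2) ⊆ ballImage ι (N + 1) (d + η / 2) := by
      rintro _ ⟨x, hx, s, hs, rfl⟩
      exact add_mem_ballImage (h.ballImage_succ _ _ (hDd hx)) hs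
    refine ⟨η / 2, half_pos hη, ⟨d + η / 2, by positivity, hsub⟩, ?_⟩
    -- An error `b` from step `N + 3` is a difference of two elements bounded in step `N + 1`, so
    -- interpolation makes it small in step `N + 2`. There it uses the other half of the slack `η`.
    obtain ⟨θ, hθ, hint⟩ := h.interpolation (N + 1) (N + 3) (c + (d + η / 2)) (by positivity)
      (η / 2) (half_pos hη)
    refine ⟨θ, hθ, ?_⟩
    rintro _ ⟨hxc, e, he, b, hb, rfl⟩
    refine hs ⟨hxc, ?_⟩
    have hb' : b ∈ ballImage ι (N + 2) (η / 2) := by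
      refine hint ⟨?_, hb⟩
      have := sub_mem_ballImage (h.ballImage_le (show n ≤ N + 1 by omega) _ hxc) (hsub he)
      simpa using this
    obtain ⟨x, hx, s, hs', rfl⟩ := mem_add.1 he
    refine mem_add.2 ⟨x, hx, s + b, ?_, (add_assoc _ _ _).symm⟩
    rw [← add_halves η]
    exact add_mem_ballImage (h.ballImage_succ _ _ hs') hb'
  · obtain ⟨N, -, D, hxD, -, η, hη, hs⟩ := hV.2 x hxV.2 0
    exact hs ⟨hxV.1, mem_add.2 ⟨x, hxD, 0, zero_mem_ballImage hη.le, add_zero _⟩⟩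

/-- A sequence escaping from the unit balls of the steps stays away from zero. -/
theorem exists_mem_nhds_forall_notMem (h : IsInterpolating ι) (y : ℕ → F)
    (hy : ∀ j, y j ∉ ballImage ι (j + 2) 1) :
    ∃ V ∈ @nhds F (topology ι) 0, ∀ j, y j ∉ V := by
  -- Invariant: `D` stays in a ball of radius below 1 in step `N`, and the points `y j` with `j < N`
  -- stay outside a thickening of `D`.
  refine (h.exists_convex_mem_nhds 0
    (fun N D => (∃ d > 0, d < 1 ∧ D ⊆ ballImage ι N d) ∧
      ∃ η > 0, ∀ j < N, y j ∉ D + ballImage ι (N + 2) η) ?_ ?_).imp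
    fun V hV => ⟨hV.1, fun j hj => ?_⟩
  · refine ⟨⟨1 / 2, by norm_num, by norm_num, ?_⟩, 1, one_pos, fun j hj => by omega⟩
    simpa using zero_mem_ballImage (by norm_num)
  · rintro N - D ⟨⟨d, hd, hd1, hDd⟩, η, hη, hs⟩
    set δ := min (η / 2) ((1 - d) / 2) with hδdef
    have hδ : 0 < δ := lt_min (half_pos hη) (by linarith)
    have hδη : δ ≤ η / 2 := min_le_left _ _
    have hδd : δ ≤ (1 - d) / 2 := min_le_right _ _
    have hsub : D + ballImage ι (N + 1) δ ⊆ ballImage ι (N + 1) (d + δ) := by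
      rintro _ ⟨x, hx, s, hs, rfl⟩
      exact add_mem_ballImage (h.ballImage_succ _ _ (hDd hx)) hs
    refine ⟨δ, hδ, ⟨d + δ, by positivity, by linarith, hsub⟩, ?_⟩
    -- If no `θ` works, `mem_add_of_forall_mem_add` improves the approximation of `y j` from step `N
    -- + 3` to step `N + 2`. For `j < N` this contradicts the old slack; for `j = N` it puts `y N`
    -- in the unit ball of step `N + 2`, as `d + δ + (1 - d) / 2 ≤ 1`.
    have key : ∀ j < N + 1, ∃ θ > 0,
        y j ∉ D + ballImage ι (N + 1) δ + ballImage ι (N + 1 + 2) θ := by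
      intro j hj
      by_contra! hcon
      rcases Nat.lt_succ_iff_lt_or_eq.1 hj with hj | rfl
      · have := h.mem_add_of_forall_mem_add (by positivity) hsub hcon (half_pos hη)
        obtain ⟨e, he, b, hb, hyj⟩ := mem_add.1 this
        obtain ⟨x, hx, s, hs', rfl⟩ := mem_add.1 he
        refine hs j hj (mem_add.2 ⟨x, hx, s + b, ?_, by rw [← add_assoc, hyj]⟩)
        rw [← add_halves η]
        exact add_mem_ballImage (h.ballImage_subset (by omega) hδη hs') hb
      · have := h.mem_add_of_forall_mem_add (by positivity) hsub hcon
          (show 0 < (1 - d) / 2 by linarith)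
        obtain ⟨e, he, b, hb, hyj⟩ := mem_add.1 this
        refine hy j (hyj ▸ ballImage_mono ?_
          (add_mem_ballImage (h.ballImage_succ _ _ (hsub he)) hb))
        linarith
    -- Smaller `θ` also work, so a common one exists for the finitely many `j`.
    have hev : ∀ j < N + 1, ∀ᶠ θ in 𝓝[>] (0 : ℝ),
        y j ∉ D + ballImage ι (N + 1) δ + ballImage ι (N + 1 + 2) θ := by
      intro j hj
      obtain ⟨θ, hθ, hyθ⟩ := key j hj
      filter_upwards [Ioo_mem_nhdsGT hθ] with τ hτ hmem
      exact hyθ (add_ballImage_mono hτ.2.le hmem)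
    obtain ⟨θ, hθ, hθ0⟩ :=
      (((finite_Iio (N + 1)).eventually_all.2 hev).and self_mem_nhdsWithin).exists
    exact ⟨θ, hθ0, hθ⟩
  · obtain ⟨N, hN, D, hD, -, η, hη, hs⟩ := hV.2 _ hj (j + 1)
    exact hs j hN (mem_add.2 ⟨y j, hD, 0, zero_mem_ballImage hη.le, add_zero _⟩)

/-- An element of `E n` lying in every neighbourhood of zero lies in every ball of step `n + 1`,
hence vanishes. -/
theorem t2Space (h : IsInterpolating ι) : @T2Space F (topology ι) := by
  let _ : TopologicalSpace F := topology ι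
  have : IsTopologicalAddGroup F := (isAdmissible_topology ι).isTopologicalAddGroup
  refine IsTopologicalAddGroup.t2Space_of_zero_sep fun y hy => ?_
  have : y ∈ ⋃ n, Set.range (ι n) := h.union ▸ mem_univ y
  obtain ⟨n, x, rfl⟩ := mem_iUnion.1 this
  by_contra! hcon
  refine hy (eq_zero_of_forall_mem_ballImage (h.injective (n + 1)) fun ε hε => ?_)
  obtain ⟨V, hV, hs⟩ := h.exists_mem_nhds_inter_subset n
    (show 0 < ‖x‖ + 1 by positivity) hε
  exact hs ⟨map_mem_ballImage (by linarith), hcon V hV⟩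

/-- Compact subsets of the direct limit are bounded in some step. -/
theorem exists_subset_ballImage (h : IsInterpolating ι) {C : Set F}
    (hC : @IsCompact F (topology ι) C) : ∃ n, ∃ c > 0, C ⊆ ballImage ι n c := by
  let _ : TopologicalSpace F := topology ι
  have : IsTopologicalAddGroup F := (isAdmissible_topology ι).isTopologicalAddGroup
  have : ContinuousSMul ℂ F := (isAdmissible_topology ι).continuousSMul
  by_contra! hcon
  -- Scaled by `1 / (j + 1)`, these points escape the unit balls, yet tend to zero because compact
  -- sets are von Neumann bounded.
  have hex : ∀ j : ℕ, ∃ x ∈ C, x ∉ ballImage ι (j + 2) ((j : ℝ) + 1) := fun j =>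
    not_subset.1 (hcon (j + 2) ((j : ℝ) + 1) (by positivity))
  choose x hxC hx using hex
  have hne : ∀ j : ℕ, (j : ℂ) + 1 ≠ 0 := fun j => Nat.cast_add_one_ne_zero j
  have hy : ∀ j : ℕ, ((1 : ℂ) / ((j : ℂ) + 1)) • x j ∉ ballImage ι (j + 2) 1 := by
    refine fun j hj => hx j ?_
    have := smul_mem_ballImage ((j : ℂ) + 1) hj
    rw [smul_smul, mul_one_div_cancel (hne j), one_smul, mul_one] at this
    refine ballImage_mono (le_of_eq ?_) this
    exact_mod_cast Complex.norm_natCast (j + 1)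
  obtain ⟨V, hV, hyV⟩ := h.exists_mem_nhds_forall_notMem _ hy
  have ht : Tendsto (fun j : ℕ => ((1 : ℂ) / ((j : ℂ) + 1)) • x j) atTop (𝓝 0) :=
    (hC.isVonNBounded ℂ).smul_tendsto_zero (Eventually.of_forall hxC)
      tendsto_one_div_add_atTop_nhds_zero_nat
  obtain ⟨j, hj⟩ := (ht.eventually hV).exists
  exact hyV j hj

theorem compactlyRegular (h : IsInterpolating ι) : CompactlyRegular ι := by
  intro C hC
  obtain ⟨n, c, hc, hCc⟩ := h.exists_subset_ballImage hC
  let _ : TopologicalSpace F := topology ι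
  have : IsTopologicalAddGroup F := (isAdmissible_topology ι).isTopologicalAddGroup
  have hex : ∀ x : C, ∃ u : E (n + 1), ι (n + 1) u = x := fun x => by
    obtain ⟨u, -, hu⟩ := mem_ballImage.1 (h.ballImage_succ n c (hCc x.2))
    exact ⟨u, hu⟩
  choose φ hφ using hex
  -- Differences of points of `C` lie in the ball of radius `c + c` of `E n`, where the limit
  -- topology controls the norm of `E (n + 1)`.
  have hcont : Continuous φ := by
    refine continuous_iff_continuousAt.2 fun x => Metric.tendsto_nhds.2 fun ε hε => ?_
    obtain ⟨V, hV, hs⟩ := h.exists_mem_nhds_inter_subset n (add_pos hc hc) (half_pos hε)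
    have ht : Tendsto (fun y : C => (y : F) - x) (𝓝 x) (𝓝 0) := by
      have : ContinuousAt (fun y : C => (y : F) - x) x :=
        (continuous_subtype_val.sub continuous_const).continuousAt
      simpa [ContinuousAt] using this
    filter_upwards [ht hV] with y hy
    have hmem := hs ⟨sub_mem_ballImage (hCc y.2) (hCc x.2), hy⟩
    rw [← hφ, ← hφ, ← map_sub] at hmem
    have := norm_le_of_map_mem_ballImage (h.injective _) hmem
    rw [dist_eq_norm]
    linarith
  have : CompactSpace C := isCompact_iff_compactSpace.1 hC
  refine ⟨n + 1, range φ, isCompact_range hcont, ?_⟩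
  rw [← range_comp, show ι (n + 1) ∘ φ = Subtype.val from funext hφ, Subtype.range_val]

end IsInterpolating

end LCLimit

/-! ### Bounded analytic maps: three circles, Taylor series, uniform limits -/

section BoundedAnalytic

open Metric
open scoped Nat

universe u

variable {X Y : Type u} [NormedAddCommGroup X] [NormedSpace ℂ X]
  [NormedAddCommGroup Y] [NormedSpace ℂ Y]

/-- Cauchy's estimate for the derivative of a bounded differentiable map on a ball. -/
theorem norm_fderiv_le_of_forall_mem_ball_norm_le {g : X → Y} {x : X} {r M : ℝ} (hr : 0 < r)
    (hg : DifferentiableOn ℂ g (ball x r)) (hM : ∀ y ∈ ball x r, ‖g y‖ ≤ M) :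
    ‖fderiv ℂ g x‖ ≤ M * (2 / r) := by
  have := Complex.norm_fderiv_le_div_of_mapsTo_ball (R₂ := 2 * M) hg (fun y hy => ?_) hr
  · exact this.trans_eq (by ring)
  · rw [mem_closedBall, dist_eq_norm]
    exact (norm_sub_le _ _).trans
      (by linarith [hM y hy, hM x (mem_ball_self hr)])

/-- A weak form of **Hadamard's three-circle theorem**. -/
theorem exists_norm_le_rpow_mul_rpow {ρ R : ℝ} (hρ : 0 < ρ) (hρ1 : ρ < 1) (hR : 1 < R) :
    ∃ θ : ℝ, 0 < θ ∧ θ < 1 ∧ ∀ (ψ : ℂ → Y) (c δ : ℝ), DifferentiableOn ℂ ψ (ball 0 R) →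
      (∀ z ∈ ball 0 R, ‖ψ z‖ ≤ c) → (∀ z ∈ ball 0 ρ, ‖ψ z‖ ≤ δ) →
      ‖ψ 1‖ ≤ δ ^ (1 - θ) * c ^ θ := by
  -- Composing with `exp` turns the annulus into a strip for the three-lines theorem. The radii `ρ /
  -- 2` and `(1 + R) / 2` keep the boundary circles inside the open balls.
  set l := Real.log (ρ / 2) with hl
  set u := Real.log ((1 + R) / 2) with hu
  have hl0 : l < 0 := Real.log_neg (by positivity) (by linarith)
  have hu0 : 0 < u := Real.log_pos (by linarith)
  have hel : Real.exp l = ρ / 2 := Real.exp_log (by positivity)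
  have heu : Real.exp u = (1 + R) / 2 := Real.exp_log (by linarith)
  refine ⟨(0 - l) / (u - l), div_pos (by linarith) (by linarith),
    (div_lt_one (by linarith)).2 (by linarith), fun ψ c δ hψ hc hδ => ?_⟩
  have hmaps : ∀ z : ℂ, z.re ≤ u → Complex.exp z ∈ ball (0 : ℂ) R := fun z hz => by
    rw [mem_ball_zero_iff, Complex.norm_exp]
    refine (Real.exp_le_exp.2 hz).trans_lt ?_
    rw [heu]
    linarith
  have hdiff : DifferentiableOn ℂ (ψ ∘ Complex.exp) {z | z.re ≤ u} :=
    hψ.comp Complex.differentiable_exp.differentiableOn hmaps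
  have h := Complex.HadamardThreeLines.norm_le_interp_of_mem_verticalClosedStrip'
    (f := ψ ∘ Complex.exp) (z := 0) (a := δ) (b := c) (l := l) (u := u) (by linarith)
    (by simp [Complex.HadamardThreeLines.verticalClosedStrip, hl0.le, hu0.le]) ?_ ?_ ?_ ?_
  · simpa using h
  · refine DifferentiableOn.diffContOnCl (hdiff.mono ?_)
    refine (closure_mono (t := {z : ℂ | z.re ≤ u}) fun z hz => hz.2.le).trans ?_
    exact (isClosed_le Complex.continuous_re continuous_const).closure_subset
  · refine ⟨c, ?_⟩
    rintro _ ⟨z, hz, rfl⟩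
    exact hc _ (hmaps z hz.2)
  · intro z hz
    refine hδ _ ?_
    rw [mem_preimage, mem_singleton_iff] at hz
    rw [mem_ball_zero_iff, Complex.norm_exp, hz, hel]
    linarith
  · intro z hz
    exact hc _ (hmaps z (le_of_eq hz))

variable [CompleteSpace Y]

/-- Cauchy's first-order estimate is applied `k` times, each time giving up `δ` of the radius. The
target varies because the induction passes from `Y` to `X →L[ℂ] Y`. -/
theorem norm_iteratedFDeriv_le_of_forall_mem_ball_norm_le (k : ℕ) :
    ∀ {Y : Type u} [NormedAddCommGroup Y] [NormedSpace ℂ Y] [CompleteSpace Y] {g : X → Y} {x : X}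
      {r δ M : ℝ}, AnalyticOnNhd ℂ g (ball x r) → (∀ y ∈ ball x r, ‖g y‖ ≤ M) → 0 < δ →
      k * δ < r → ‖iteratedFDeriv ℂ k g x‖ ≤ M * (2 / δ) ^ k := by
  induction k with
  | zero =>
    intro Y _ _ _ g x r δ M _ hM _ hr
    have hr' : 0 < r := by simpa using hr
    simpa using hM x (mem_ball_self hr')
  | succ k ih =>
    intro Y _ _ _ g x r δ M hg hM hδ hr
    push_cast at hr
    have hsub : ∀ y ∈ ball x (r - δ), ball y δ ⊆ ball x r := fun y hy => by
      refine ball_subset_ball' ?_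
      rw [mem_ball] at hy
      linarith
    rw [← norm_iteratedFDeriv_fderiv]
    refine (ih (M := M * (2 / δ)) (r := r - δ) (hg.fderiv.mono (ball_subset_ball (by linarith)))
      (fun y hy => ?_) hδ (by linarith)).trans_eq (by ring)
    exact norm_fderiv_le_of_forall_mem_ball_norm_le hδ (hg.differentiableOn.mono (hsub y hy))
      fun z hz => hM z (hsub y hy hz)

/-- The Taylor series of a map at a point. -/
noncomputable def taylorFormalSeries (g : X → Y) (x : X) : FormalMultilinearSeries ℂ X Y :=
  fun k => (k ! : ℂ)⁻¹ • iteratedFDeriv ℂ k g x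

/-- Taking `δ = r / (k + 1)` produces the factor `(k + 1) ^ k / k !`, which equals `(k + 1) ^ (k +
1) / (k + 1)!` and so is at most `e ^ (k + 1)`. -/
theorem norm_taylorFormalSeries_le {g : X → Y} {x : X} {r M : ℝ} (hr : 0 < r)
    (hg : AnalyticOnNhd ℂ g (ball x r)) (hM : ∀ y ∈ ball x r, ‖g y‖ ≤ M) (k : ℕ) :
    ‖taylorFormalSeries g x k‖ ≤ M * Real.exp 1 * (2 * Real.exp 1 / r) ^ k := by
  have hM0 : 0 ≤ M := (norm_nonneg _).trans (hM x (mem_ball_self hr))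
  have hk : (0 : ℝ) < (k : ℝ) + 1 := by positivity
  have h1 : ‖iteratedFDeriv ℂ k g x‖ ≤ M * (2 / (r / (k + 1))) ^ k := by
    refine norm_iteratedFDeriv_le_of_forall_mem_ball_norm_le k hg hM (by positivity) ?_
    rw [mul_div_assoc', div_lt_iff₀ hk]
    nlinarith
  have h2 : ((k : ℝ) + 1) ^ k / k ! ≤ Real.exp 1 * Real.exp 1 ^ k := by
    have := Real.pow_div_factorial_le_exp ((k : ℝ) + 1) hk.le (k + 1)
    rw [← pow_succ', ← Real.exp_nat_mul, mul_one]
    refine le_of_eq_of_le ?_ (this.trans_eq (by push_cast; rfl))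
    rw [Nat.factorial_succ]
    push_cast
    field_simp
    ring
  rw [taylorFormalSeries, norm_smul, norm_inv, Complex.norm_natCast]
  calc ((k ! : ℝ))⁻¹ * ‖iteratedFDeriv ℂ k g x‖
      ≤ ((k ! : ℝ))⁻¹ * (M * (2 / (r / (k + 1))) ^ k) := by gcongr
    _ = M * (2 / r) ^ k * (((k : ℝ) + 1) ^ k / k !) := by
        rw [div_div_eq_mul_div, mul_div_right_comm, mul_pow]
        ring
    _ ≤ M * (2 / r) ^ k * (Real.exp 1 * Real.exp 1 ^ k) := by gcongr
    _ = M * Real.exp 1 * (2 * Real.exp 1 / r) ^ k := by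
        rw [mul_div_right_comm, mul_pow]
        ring

theorem le_radius_of_norm_le_mul_pow (p : FormalMultilinearSeries ℂ X Y) {A B : ℝ} (hB : 0 < B)
    (h : ∀ k, ‖p k‖ ≤ A * B ^ k) : ENNReal.ofReal B⁻¹ ≤ p.radius := by
  refine p.le_radius_of_bound A fun k => ?_
  rw [Real.coe_toNNReal _ (by positivity), inv_pow, ← div_eq_mul_inv,
    div_le_iff₀ (by positivity)]
  exact h k

/-- The Taylor series of a bounded analytic map on a ball of radius `r` represents the map on a ball
whose radius only depends on `r`. -/
theorem hasFPowerSeriesOnBall_taylorFormalSeries {g : X → Y} {x : X} {r M : ℝ} (hr : 0 < r)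
    (hg : AnalyticOnNhd ℂ g (ball x r)) (hM : ∀ y ∈ ball x r, ‖g y‖ ≤ M) :
    HasFPowerSeriesOnBall g (taylorFormalSeries g x) x
      (ENNReal.ofReal (2 * Real.exp 1 / r)⁻¹) := by
  have he := Real.exp_pos 1
  set B := 2 * Real.exp 1 / r with hB
  have hB0 : 0 < B := by positivity
  have hrad := le_radius_of_norm_le_mul_pow _ hB0 (norm_taylorFormalSeries_le hr hg hM)
  have hpos : 0 < ENNReal.ofReal B⁻¹ := ENNReal.ofReal_pos.2 (by positivity)
  have hsum := ((taylorFormalSeries g x).hasFPowerSeriesOnBall (hpos.trans_le hrad)).mono hpos hrad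
  have hsum' : HasFPowerSeriesOnBall (fun y => (taylorFormalSeries g x).sum (y - x))
      (taylorFormalSeries g x) x (ENNReal.ofReal B⁻¹) := by
    simpa using hsum.comp_sub x
  have hsub : eball x (ENNReal.ofReal B⁻¹) ⊆ ball x r := by
    rw [eball_ofReal]
    refine ball_subset_ball ?_
    rw [hB, inv_div]
    exact div_le_self hr.le (by linarith [Real.add_one_le_exp (1 : ℝ)])
  refine hsum'.congr ?_
  -- The sum of the Taylor series agrees with `g` near `x`; the identity theorem extends this to the
  -- ball.
  refine AnalyticOnNhd.eqOn_of_preconnected_of_eventuallyEq hsum'.analyticOnNhd (hg.mono hsub)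
    ?_ (mem_eball_self hpos) ?_
  · rw [eball_ofReal]
    exact (convex_ball x _).isPreconnected
  · obtain ⟨p, s, hp⟩ := hg x (mem_ball_self hr)
    filter_upwards [eball_mem_nhds x hp.r_pos] with y hy
    have hy' : y - x ∈ eball 0 s := by
      rwa [mem_eball, edist_zero_right, ← edist_eq_enorm_sub]
    have := hp.hasSum_iteratedFDeriv hy'
    rw [add_sub_cancel] at this
    exact this.tsum_eq

/-- Uniform limits of analytic maps between complex Banach spaces are analytic. -/
theorem TendstoUniformlyOn.analyticOnNhd {f : ℕ → X → Y} {g : X → Y} {U : Set X}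
    (hU : IsOpen U) (hfg : TendstoUniformlyOn f g atTop U) (hf : ∀ i, AnalyticOnNhd ℂ (f i) U) :
    AnalyticOnNhd ℂ g U := by
  intro x hx
  have hgc : ContinuousOn g U :=
    hfg.continuousOn (Eventually.of_forall fun i => (hf i).continuousOn).frequently
  obtain ⟨r, hr, hrs⟩ : ∃ r > 0, ball x r ⊆ U ∩ {y | ‖g y‖ ≤ ‖g x‖ + 1} := by
    refine Metric.mem_nhds_iff.1 (inter_mem (hU.mem_nhds hx) ?_)
    have := (hgc.continuousAt (hU.mem_nhds hx)).norm
    exact this.eventually_le_const (by linarith)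
  have hrU : ball x r ⊆ U := fun y hy => (hrs hy).1
  set M := ‖g x‖ + 1 + 1 with hM
  obtain ⟨N, hN⟩ := eventually_atTop.1 (Metric.tendstoUniformlyOn_iff.1 hfg 1 one_pos)
  have hfM : ∀ i ≥ N, ∀ y ∈ ball x r, ‖f i y‖ ≤ M := fun i hi y hy => by
    have h1 := hN i hi y (hrU hy)
    have h2 : ‖g y‖ ≤ ‖g x‖ + 1 := (hrs hy).2
    rw [dist_comm, dist_eq_norm] at h1
    linarith [norm_le_norm_add_norm_sub' (f i y) (g y)]
  have he := Real.exp_pos 1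
  set B := 2 * Real.exp 1 / r with hB
  have hB0 : 0 < B := by positivity
  -- For fixed `k`, the coefficient estimate applied to `f i - f j` shows that the coefficients are
  -- Cauchy.
  have hlim : ∀ k, ∃ p, Tendsto (fun i => taylorFormalSeries (f i) x k) atTop (𝓝 p) := by
    intro k
    refine cauchySeq_tendsto_of_complete (Metric.cauchySeq_iff.2 fun ε hε => ?_)
    set A := Real.exp 1 * B ^ k with hA
    have hA0 : 0 < A := by positivity
    obtain ⟨m, hm⟩ := eventually_atTop.1
      (Metric.tendstoUniformlyOn_iff.1 hfg (ε / (4 * A)) (by positivity))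
    refine ⟨m, fun i hi j hj => ?_⟩
    have hd : AnalyticOnNhd ℂ (f i - f j) (ball x r) := ((hf i).sub (hf j)).mono hrU
    have hle : ∀ y ∈ ball x r, ‖(f i - f j) y‖ ≤ ε / (2 * A) := fun y hy => by
      have h1 := hm i hi y (hrU hy)
      have h2 := hm j hj y (hrU hy)
      rw [Pi.sub_apply, ← dist_eq_norm]
      refine (dist_triangle_left _ _ (g y)).trans ?_
      have : ε / (2 * A) = ε / (4 * A) + ε / (4 * A) := by field_simp; norm_num
      linarith
    have hT : taylorFormalSeries (f i) x k - taylorFormalSeries (f j) x k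
        = taylorFormalSeries (f i - f j) x k := by
      rw [taylorFormalSeries, taylorFormalSeries, taylorFormalSeries, ← smul_sub,
        iteratedFDeriv_sub_apply (hf i x hx).contDiffAt (hf j x hx).contDiffAt]
    rw [dist_eq_norm, hT]
    refine (norm_taylorFormalSeries_le hr hd hle k).trans_lt ?_
    rw [mul_assoc, ← hA]
    have : ε / (2 * A) * A = ε / 2 := by field_simp
    linarith
  choose p hp using hlim
  have hpb : ∀ k, ‖p k‖ ≤ M * Real.exp 1 * B ^ k := fun k => by
    refine le_of_tendsto (hp k).norm ?_
    filter_upwards [eventually_ge_atTop N] with i hi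
    exact norm_taylorFormalSeries_le hr ((hf i).mono hrU) (hfM i hi) k
  have hrad := le_radius_of_norm_le_mul_pow (p : FormalMultilinearSeries ℂ X Y) hB0 hpb
  refine ⟨p, ENNReal.ofReal B⁻¹, hrad, ENNReal.ofReal_pos.2 (by positivity), fun {y} hy => ?_⟩
  have hsum : HasSum (fun k => p k fun _ => y) (FormalMultilinearSeries.sum p y) :=
    FormalMultilinearSeries.hasSum p (eball_subset_eball hrad hy)
  have hyB : B * ‖y‖ < 1 := by
    rw [eball_ofReal, mem_ball_zero_iff] at hy
    rw [← mul_inv_cancel₀ hB0.ne']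
    gcongr
  have hyU : x + y ∈ U := by
    refine hrU ?_
    rw [mem_ball, dist_self_add_left]
    have : 1 / r ≤ B := by
      rw [hB]
      gcongr
      linarith [Real.add_one_le_exp (1 : ℝ)]
    have : 1 / r * ‖y‖ < 1 := (mul_le_mul_of_nonneg_right this (norm_nonneg _)).trans_lt hyB
    rwa [one_div, inv_mul_lt_iff₀ hr, mul_one] at this
  -- The common geometric bound permits passing to the limit termwise.
  have h1 : Tendsto (fun i => ∑' k, taylorFormalSeries (f i) x k fun _ => y) atTop
      (𝓝 (∑' k, p k fun _ => y)) := by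
    refine tendsto_tsum_of_dominated_convergence
      (bound := fun k => M * Real.exp 1 * (B * ‖y‖) ^ k)
      ((summable_geometric_of_lt_one (by positivity) hyB).mul_left _) (fun k => ?_) ?_
    · exact ((ContinuousMultilinearMap.apply ℂ (fun _ : Fin k => X) Y
        (fun _ => y)).continuous.tendsto _).comp (hp k)
    · filter_upwards [eventually_ge_atTop N] with i hi k
      refine ((taylorFormalSeries (f i) x k).le_opNorm _).trans ?_
      rw [Finset.prod_const, Finset.card_univ, Fintype.card_fin, mul_pow, ← mul_assoc]
      gcongr
      exact norm_taylorFormalSeries_le hr ((hf i).mono hrU) (hfM i hi) k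
  have h2 : Tendsto (fun i => ∑' k, taylorFormalSeries (f i) x k fun _ => y) atTop
      (𝓝 (g (x + y))) := by
    refine (hfg.tendsto_at hyU).congr' ?_
    filter_upwards [eventually_ge_atTop N] with i hi
    exact ((hasFPowerSeriesOnBall_taylorFormalSeries hr ((hf i).mono hrU)
      (hfM i hi)).hasSum hy).tsum_eq.symm
  rw [← tendsto_nhds_unique h1 h2]
  exact hsum.summable.hasSum

end BoundedAnalytic

/-! ### Germs of analytic maps along `K` -/

namespace AnalyticGerm

open Metric LCLimit

universe u

variable {X : Type u} [NormedAddCommGroup X] [NormedSpace ℂ X] {K : Set X}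

theorem ball_subset_U {a : X} (ha : a ∈ K) (n : ℕ) : ball a (1 / ((n : ℝ) + 1)) ⊆ U K n :=
  fun _ hx => mem_biUnion ha hx

theorem exists_mem_ball_of_mem_U {n : ℕ} {x : X} (hx : x ∈ U K n) :
    ∃ a ∈ K, x ∈ ball a (1 / ((n : ℝ) + 1)) := by
  simpa [U] using hx

/-- Points of `U K (n + 1)` are centres of balls of a fixed radius that are contained in `U K n`. -/
theorem exists_ball_subset_U (K : Set X) (n : ℕ) :
    ∃ d > 0, ∀ x ∈ U K (n + 1), ball x d ⊆ U K n := by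
  have hlt : 1 / (((n + 1 : ℕ) : ℝ) + 1) < 1 / ((n : ℝ) + 1) := by
    push_cast
    gcongr
    linarith
  refine ⟨1 / ((n : ℝ) + 1) - 1 / (((n + 1 : ℕ) : ℝ) + 1), sub_pos.2 hlt, fun x hx => ?_⟩
  obtain ⟨a, ha, hxa⟩ := exists_mem_ball_of_mem_U hx
  refine (ball_subset_ball' ?_).trans (ball_subset_U ha n)
  rw [mem_ball] at hxa
  linarith

theorem eqOn_ball_of_eventuallyEq_nhdsSet {f g : X → X} {a : X} {r : ℝ} (hr : 0 < r) (ha : a ∈ K)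
    (hf : AnalyticOnNhd ℂ f (ball a r)) (hg : AnalyticOnNhd ℂ g (ball a r))
    (h : f =ᶠ[𝓝ˢ K] g) : EqOn f g (ball a r) :=
  hf.eqOn_of_preconnected_of_eventuallyEq hg (convex_ball a r).isPreconnected
    (mem_ball_self hr) (h.filter_mono (nhds_le_nhdsSet ha))

section HolB

variable {n m : ℕ}

theorem norm_zeroExt_le (f : HolB K n) {x : X} (hx : x ∈ U K n) :
    ‖zeroExt (f : U K n →ᵇ X) x‖ ≤ ‖f‖ := by
  rw [zeroExt_of_mem _ hx]
  exact (f : U K n →ᵇ X).norm_coe_le_norm _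

theorem norm_le_of_forall_norm_zeroExt_le (f : HolB K n) {c : ℝ} (hc : 0 ≤ c)
    (h : ∀ x ∈ U K n, ‖zeroExt (f : U K n →ᵇ X) x‖ ≤ c) : ‖f‖ ≤ c := by
  refine ((f : U K n →ᵇ X).norm_le hc).2 fun x => ?_
  have := h x x.2
  rwa [zeroExt_of_mem _ x.2] at this

theorem zeroExt_restrict (h : n ≤ m) (f : HolB K n) {x : X} (hx : x ∈ U K m) :
    zeroExt (restrict K h f : U K m →ᵇ X) x = zeroExt (f : U K n →ᵇ X) x := by
  rw [zeroExt_of_mem _ hx, zeroExt_of_mem _ (U_anti K h hx)]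
  rfl

theorem norm_restrict_le (h : n ≤ m) (f : HolB K n) : ‖restrict K h f‖ ≤ ‖f‖ :=
  norm_le_of_forall_norm_zeroExt_le _ (norm_nonneg _) fun x hx => by
    rw [zeroExt_restrict h f hx]
    exact norm_zeroExt_le f (U_anti K h hx)

/-- Restriction as a continuous linear map. -/
noncomputable def restrictCLM (K : Set X) (h : n ≤ m) : HolB K n →L[ℂ] HolB K m :=
  LinearMap.mkContinuous
    { toFun := restrict K h
      map_add' := fun _ _ => rfl
      map_smul' := fun _ _ => rfl } 1 fun f => by
    rw [one_mul]
    exact norm_restrict_le h f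

theorem holIncl_restrict (h : n ≤ m) (f : HolB K n) :
    holIncl K m (restrict K h f) = holIncl K n f :=
  Subtype.ext (germ_restrict K h f)

theorem eventuallyEq_of_holIncl_eq {f : HolB K n} {g : HolB K m}
    (h : holIncl K n f = holIncl K m g) :
    zeroExt (f : U K n →ᵇ X) =ᶠ[𝓝ˢ K] zeroExt (g : U K m →ᵇ X) :=
  Filter.Germ.coe_eq.1 (Subtype.ext_iff.1 h)

/-- Every point of `U K n` lies in a ball centred in `K`, where the identity theorem applies. -/
theorem holIncl_injective (K : Set X) (n : ℕ) : Function.Injective (holIncl K n) := by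
  intro f g h
  refine Subtype.ext (BoundedContinuousFunction.ext fun x => ?_)
  obtain ⟨a, ha, hxa⟩ := exists_mem_ball_of_mem_U x.2
  have := eqOn_ball_of_eventuallyEq_nhdsSet (by positivity) ha (f.2.1.mono (ball_subset_U ha n))
    (g.2.1.mono (ball_subset_U ha n)) (eventuallyEq_of_holIncl_eq h) hxa
  rwa [zeroExt_of_mem _ x.2, zeroExt_of_mem _ x.2] at this

theorem iUnion_range_holIncl (K : Set X) : ⋃ n, Set.range (holIncl K n) = Set.univ := by
  refine eq_univ_of_forall fun y => ?_
  obtain ⟨n, f, hf⟩ := mem_iUnion.1 y.2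
  exact mem_iUnion.2 ⟨n, f, Subtype.ext hf⟩

theorem tendstoUniformlyOn_zeroExt {ι : Type*} {l : Filter ι} {W : Set X} {f : ι → W →ᵇ X}
    {g : W →ᵇ X} (h : Tendsto f l (𝓝 g)) :
    TendstoUniformlyOn (fun i => zeroExt (f i)) (zeroExt g) l W := by
  refine Metric.tendstoUniformlyOn_iff.2 fun ε hε => ?_
  filter_upwards [Metric.tendsto_nhds.1 h ε hε] with i hi x hx
  rw [zeroExt_of_mem _ hx, zeroExt_of_mem _ hx, dist_comm]
  exact (BoundedContinuousFunction.dist_coe_le_dist _).trans_lt hi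

variable [CompleteSpace X]

theorem isClosed_holB (K : Set X) (n : ℕ) : IsClosed (HolB K n : Set (U K n →ᵇ X)) := by
  refine IsSeqClosed.isClosed fun f g hf hfg => ⟨?_, fun x hx => ?_⟩
  · exact (tendstoUniformlyOn_zeroExt hfg).analyticOnNhd (isOpen_U K n) fun i => (hf i).1
  · have h1 : Tendsto (fun i => f i x) atTop (𝓝 (g x)) :=
      (BoundedContinuousFunction.tendsto_iff_tendstoUniformly.1 hfg).tendsto_at x
    exact tendsto_nhds_unique h1 (tendsto_const_nhds.congr fun i => ((hf i).2 x hx).symm)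

instance (K : Set X) (n : ℕ) : CompleteSpace (HolB K n) :=
  (isClosed_holB K n).completeSpace_coe

theorem holIncl_interpolation (K : Set X) (n l : ℕ) (c : ℝ) {ε : ℝ} (hε : 0 < ε) :
    ∃ δ > 0, ballImage (holIncl K) n c ∩ ballImage (holIncl K) l δ ⊆
      ballImage (holIncl K) (n + 1) ε := by
  set r := 1 / ((n : ℝ) + 1) with hr
  set r' := 1 / (((n + 1 : ℕ) : ℝ) + 1) with hr'
  set s := 1 / ((l : ℝ) + 1) with hs
  have hr0 : 0 < r := by positivity
  have hr'0 : 0 < r' := by positivity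
  have hs0 : 0 < s := by positivity
  have hlt : r' < r := by
    rw [hr, hr']
    push_cast
    gcongr
    linarith
  -- `σ ≤ s` keeps the small ball in the domain of `g`; `σ ≤ r' / 2` makes the inner radius `σ / r'`
  -- less than 1.
  set σ := min s (r' / 2) with hσ
  have hσ0 : 0 < σ := lt_min hs0 (half_pos hr'0)
  have hσs : σ ≤ s := min_le_left _ _
  have hσr : σ ≤ r' / 2 := min_le_right _ _
  obtain ⟨θ, hθ0, hθ1, H⟩ := exists_norm_le_rpow_mul_rpow (Y := X) (ρ := σ / r') (R := r / r')
    (by positivity) ((div_lt_one hr'0).2 (by linarith)) ((one_lt_div hr'0).2 hlt)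
  obtain ⟨δ, hδε, hδ⟩ : ∃ δ : ℝ, δ ^ (1 - θ) * c ^ θ < ε ∧ 0 < δ := by
    have ht : Tendsto (fun δ : ℝ => δ ^ (1 - θ) * c ^ θ) (𝓝[>] 0) (𝓝 0) := by
      have : ContinuousAt (fun δ : ℝ => δ ^ (1 - θ) * c ^ θ) 0 :=
        (Real.continuousAt_rpow_const 0 (1 - θ) (Or.inr (by linarith))).mul_const _
      rw [ContinuousAt, Real.zero_rpow (by linarith), zero_mul] at this
      exact this.mono_left nhdsWithin_le_nhds
    exact ((ht.eventually_lt_const hε).and self_mem_nhdsWithin).exists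
  refine ⟨δ, hδ, ?_⟩
  rintro y ⟨hy1, hy2⟩
  obtain ⟨f, hf, rfl⟩ := mem_ballImage.1 hy1
  obtain ⟨g, hg, hgf⟩ := mem_ballImage.1 hy2
  refine mem_ballImage.2 ⟨restrict K n.le_succ f, ?_, holIncl_restrict _ f⟩
  refine norm_le_of_forall_norm_zeroExt_le _ hε.le fun x hx => ?_
  rw [zeroExt_restrict _ f hx]
  obtain ⟨a, ha, hxa⟩ := exists_mem_ball_of_mem_U hx
  have hxa' : ‖x - a‖ < r' := by rwa [mem_ball, dist_eq_norm] at hxa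
  have hmaps : ∀ t : ℝ, ∀ z ∈ ball (0 : ℂ) (t / r'), a + z • (x - a) ∈ ball a t := by
    intro t z hz
    rw [mem_ball_zero_iff, lt_div_iff₀ hr'0] at hz
    rw [mem_ball, dist_self_add_left, norm_smul]
    exact (mul_le_mul_of_nonneg_left hxa'.le (norm_nonneg _)).trans_lt hz
  have hball := ball_subset_U ha n
  -- Equality of germs transfers the bound `δ` from `g` to `f` near `a`.
  have heq : EqOn (zeroExt (g : U K l →ᵇ X)) (zeroExt (f : U K n →ᵇ X)) (ball a σ) :=
    eqOn_ball_of_eventuallyEq_nhdsSet hσ0 ha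
      (g.2.1.mono ((ball_subset_ball hσs).trans (ball_subset_U ha l)))
      (f.2.1.mono ((ball_subset_ball (by linarith)).trans hball)) (eventuallyEq_of_holIncl_eq hgf)
  have := H (fun z => zeroExt (f : U K n →ᵇ X) (a + z • (x - a))) c δ ?_ ?_ ?_
  · rw [one_smul, add_sub_cancel] at this
    exact this.trans hδε.le
  · refine (f.2.1.mono hball).differentiableOn.comp (Differentiable.differentiableOn ?_)
      (hmaps r)
    fun_prop
  · exact fun z hz => (norm_zeroExt_le f (hball (hmaps r z hz))).trans hf
  · intro z hz
    rw [← heq (hmaps σ z hz)]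
    exact (norm_zeroExt_le g (ball_subset_U ha l
      (ball_subset_ball hσs (hmaps σ z hz)))).trans hg

theorem isInterpolating_holIncl (K : Set X) : IsInterpolating (holIncl K) where
  complete _ := inferInstance
  injective := holIncl_injective K
  union := iUnion_range_holIncl K
  ballImage_succ n c := by
    intro y hy
    obtain ⟨f, hf, rfl⟩ := mem_ballImage.1 hy
    exact mem_ballImage.2 ⟨restrict K n.le_succ f, (norm_restrict_le _ f).trans hf,
      holIncl_restrict _ f⟩
  interpolation n l c _ _ hε := holIncl_interpolation K n l c hε

theorem isBanachUnion_holIncl (K : Set X) : IsBanachUnion (holIncl K) where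
  complete _ := inferInstance
  injective := holIncl_injective K
  bonding n := ⟨restrictCLM K n.le_succ, holIncl_restrict n.le_succ⟩
  union := iUnion_range_holIncl K

end HolB

/-! ### Completeness of the spaces with bounded derivative -/

namespace BC1

variable [CompleteSpace X] {n : ℕ}

theorem norm_fderiv_le (f : BC1 K n) {x : X} (hx : x ∈ U K n) :
    ‖fderiv ℂ (zeroExt (toHolB K n f : U K n →ᵇ X)) x‖ ≤ ‖f‖ :=
  (deriv K n f).norm_coe_le_norm ⟨x, hx⟩

theorem norm_le_of_forall_norm_fderiv_le (f : BC1 K n) {c : ℝ} (hc : 0 ≤ c)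
    (h : ∀ x ∈ U K n, ‖fderiv ℂ (zeroExt (toHolB K n f : U K n →ᵇ X)) x‖ ≤ c) : ‖f‖ ≤ c :=
  ((deriv K n f).norm_le hc).2 fun x => h x x.2

theorem toHolB_injective (K : Set X) (n : ℕ) : Function.Injective (toHolB K n) :=
  Subtype.val_injective

/-- Mean value inequality on a ball centred at a point of `K`, where the map vanishes. -/
theorem norm_toHolB_le (f : BC1 K n) : ‖toHolB K n f‖ ≤ 1 / ((n : ℝ) + 1) * ‖f‖ := by
  refine norm_le_of_forall_norm_zeroExt_le _ (by positivity) fun x hx => ?_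
  obtain ⟨a, ha, hxa⟩ := exists_mem_ball_of_mem_U hx
  have hsub := ball_subset_U ha n
  have haU := subset_U K n ha
  have := (convex_ball a (1 / ((n : ℝ) + 1))).norm_image_sub_le_of_norm_fderiv_le (𝕜 := ℂ)
    (fun y hy => ((toHolB K n f).2.1 y (hsub hy)).differentiableAt)
    (fun y hy => norm_fderiv_le f (hsub hy)) (mem_ball_self (by positivity)) hxa
  rw [zeroExt_of_mem _ haU, (toHolB K n f).2.2 ⟨a, haU⟩ ha, sub_zero] at this
  refine this.trans ?_
  rw [mul_comm]
  gcongr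
  rw [← dist_eq_norm]
  exact (mem_ball.1 hxa).le

/-- The inclusion of `BC¹(U_n, X)_K` into `Hol_b(U_n, X)_K` as a continuous linear map. -/
noncomputable def toHolBCLM (K : Set X) (n : ℕ) : BC1 K n →L[ℂ] HolB K n :=
  (toHolB K n).mkContinuous _ norm_toHolB_le

instance (K : Set X) (n : ℕ) : CompleteSpace (BC1 K n) := by
  refine Metric.complete_of_cauchySeq_tendsto fun v hv => ?_
  have hiso : Isometry (deriv K n) := Isometry.of_dist_eq fun _ _ => rfl
  obtain ⟨g, hg⟩ := cauchySeq_tendsto_of_complete (hiso.uniformContinuous.comp_cauchySeq hv)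
  obtain ⟨f, hf⟩ := cauchySeq_tendsto_of_complete ((toHolBCLM K n).uniformContinuous.comp_cauchySeq hv)
  have hf' : TendstoUniformlyOn (fun i => zeroExt (toHolB K n (v i) : U K n →ᵇ X))
      (zeroExt (f : U K n →ᵇ X)) atTop (U K n) :=
    tendstoUniformlyOn_zeroExt ((continuous_subtype_val.tendsto f).comp hf)
  classical
  let G : X → X →L[ℂ] X := fun x => if h : x ∈ U K n then g ⟨x, h⟩ else 0
  have hG : ∀ x : U K n, G x = g x := fun x => dif_pos x.2
  have hG' : TendstoUniformlyOn
      (fun i => fderiv ℂ (zeroExt (toHolB K n (v i) : U K n →ᵇ X))) G atTop (U K n) := by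
    refine Metric.tendstoUniformlyOn_iff.2 fun ε hε => ?_
    filter_upwards [Metric.tendsto_nhds.1 hg ε hε] with i hi x hx
    rw [hG ⟨x, hx⟩, dist_comm]
    exact (BoundedContinuousFunction.dist_coe_le_dist (f := deriv K n (v i)) ⟨x, hx⟩).trans_lt hi
  -- The maps converge to `f` and their derivatives converge uniformly to `g`, so `g` is the
  -- derivative of `f`.
  have hd : ∀ x : U K n, fderiv ℂ (zeroExt (f : U K n →ᵇ X)) x = g x := fun x => by
    rw [← hG]
    exact (hasFDerivAt_of_tendstoUniformlyOn (isOpen_U K n) hG'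
      (fun i y hy => ((toHolB K n (v i)).2.1 y hy).differentiableAt.hasFDerivAt)
      (fun y hy => hf'.tendsto_at hy) x.2).fderiv
  let w : BC1 K n := ⟨f, ‖g‖, fun x hx => by
    rw [hd ⟨x, hx⟩]
    exact g.norm_coe_le_norm _⟩
  refine ⟨w, hiso.isEmbedding.tendsto_nhds_iff.2 ?_⟩
  rwa [show deriv K n w = g from BoundedContinuousFunction.ext hd]

end BC1

/-! ### Comparison of the two sequences -/

section toBC1

variable {n : ℕ}

theorem fderiv_zeroExt_restrict {n m : ℕ} (h : n ≤ m) (f : HolB K n) {x : X} (hx : x ∈ U K m) :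
    fderiv ℂ (zeroExt (restrict K h f : U K m →ᵇ X)) x
      = fderiv ℂ (zeroExt (f : U K n →ᵇ X)) x := by
  refine Filter.EventuallyEq.fderiv_eq ?_
  filter_upwards [(isOpen_U K m).mem_nhds hx] with y hy
  exact zeroExt_restrict h f hy

/-- Cauchy's estimate on balls of one fixed radius inside `U K n`; this makes restriction to `BC1 K
(n + 1)` continuous. -/
theorem exists_norm_fderiv_restrict_le (K : Set X) (n : ℕ) :
    ∃ C : ℝ, 0 ≤ C ∧ ∀ f : HolB K n, ∀ x ∈ U K (n + 1),
      ‖fderiv ℂ (zeroExt (restrict K n.le_succ f : U K (n + 1) →ᵇ X)) x‖ ≤ C * ‖f‖ := by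
  obtain ⟨d, hd, hsub⟩ := exists_ball_subset_U K n
  refine ⟨2 / d, by positivity, fun f x hx => ?_⟩
  rw [fderiv_zeroExt_restrict _ f hx, mul_comm]
  exact norm_fderiv_le_of_forall_mem_ball_norm_le hd (f.2.1.mono (hsub x hx)).differentiableOn
    fun y hy => norm_zeroExt_le f (hsub x hx hy)

variable [CompleteSpace X]

/-- Restriction `Hol_b(U_n, X)_K → BC¹(U_{n+1}, X)_K`. -/
noncomputable def toBC1 (K : Set X) (n : ℕ) : HolB K n →L[ℂ] BC1 K (n + 1) :=
  LinearMap.mkContinuous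
    { toFun := fun f => ⟨restrict K n.le_succ f, _,
        (exists_norm_fderiv_restrict_le K n).choose_spec.2 f⟩
      map_add' := fun _ _ => rfl
      map_smul' := fun _ _ => rfl } (exists_norm_fderiv_restrict_le K n).choose fun f =>
    BC1.norm_le_of_forall_norm_fderiv_le _
      (mul_nonneg (exists_norm_fderiv_restrict_le K n).choose_spec.1 (norm_nonneg _))
      ((exists_norm_fderiv_restrict_le K n).choose_spec.2 f)

theorem bc1Incl_toBC1 (f : HolB K n) : bc1Incl K (n + 1) (toBC1 K n f) = holIncl K n f :=
  holIncl_restrict n.le_succ f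

theorem isBanachUnion_bc1Incl (K : Set X) : IsBanachUnion (bc1Incl K) where
  complete _ := inferInstance
  injective n := (holIncl_injective K n).comp (BC1.toHolB_injective K n)
  bonding n := ⟨(toBC1 K n).comp (BC1.toHolBCLM K n), fun f => bc1Incl_toBC1 (BC1.toHolB K n f)⟩
  union := by
    refine eq_univ_of_forall fun y => ?_
    obtain ⟨n, f, rfl⟩ := mem_iUnion.1 (iUnion_range_holIncl K ▸ mem_univ y)
    exact mem_iUnion.2 ⟨n + 1, toBC1 K n f, bc1Incl_toBC1 f⟩

/-- Each step of either sequence maps continuously into a step of the other, compatibly with germs.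
-/
theorem isAdmissible_holIncl_iff (K : Set X) (t : TopologicalSpace (GermK K)) :
    IsAdmissible (holIncl K) t ↔ IsAdmissible (bc1Incl K) t := by
  refine ⟨fun h => ⟨h.1, h.2, h.3, fun n => ?_⟩, fun h => ⟨h.1, h.2, h.3, fun n => ?_⟩⟩
  · exact (h.continuous n).comp (BC1.toHolBCLM K n).continuous
  · exact ((h.continuous (n + 1)).comp (toBC1 K n).continuous).congr bc1Incl_toBC1

theorem topology_holIncl_eq (K : Set X) : topology (holIncl K) = topology (bc1Incl K) :=
  congrArg sInf (Set.ext (isAdmissible_holIncl_iff K))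

theorem compactlyRegular_bc1Incl (K : Set X) : CompactlyRegular (bc1Incl K) := by
  intro C hC
  rw [← topology_holIncl_eq] at hC
  obtain ⟨n, C', hC', rfl⟩ := (isInterpolating_holIncl K).compactlyRegular C hC
  refine ⟨n + 1, toBC1 K n '' C', hC'.image (toBC1 K n).continuous, ?_⟩
  rw [image_image]
  exact image_congr fun f _ => bc1Incl_toBC1 f

end toBC1

end AnalyticGerm

theorem proposition3p3 {X : Type*} [NormedAddCommGroup X] [NormedSpace ℂ X] [CompleteSpace X]
    (K : Set X) (hK : IsCompact K) (hne : K.Nonempty) :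
    LCLimit.IsBanachUnion (AnalyticGerm.holIncl K) ∧
    LCLimit.IsBanachUnion (AnalyticGerm.bc1Incl K) ∧
    LCLimit.topology (AnalyticGerm.holIncl K) = LCLimit.topology (AnalyticGerm.bc1Incl K) ∧
    T2Space (AnalyticGerm.GermK K) ∧
    LCLimit.CompactlyRegular (AnalyticGerm.holIncl K) ∧
    LCLimit.CompactlyRegular (AnalyticGerm.bc1Incl K) :=
  ⟨AnalyticGerm.isBanachUnion_holIncl K, AnalyticGerm.isBanachUnion_bc1Incl K,
    AnalyticGerm.topology_holIncl_eq K, (AnalyticGerm.isInterpolating_holIncl K).t2Space,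
    (AnalyticGerm.isInterpolating_holIncl K).compactlyRegular,
    AnalyticGerm.compactlyRegular_bc1Incl K⟩
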